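/- Let $M$ be a smooth (Hausdorff) manifold of dimension $n$ with a smooth Riemannian metric $g$, and let $(\phi,\xi,\eta,g)$ be an almost contact metric structure on $M$: $\phi$ is a smooth $(1,1)$-tensor field, $\xi$ a smooth vector field and $\eta$ a smooth 1-form with $$\phi^2=-\mathrm{id}+\eta\otimes\xi,\quad \eta(\xi)=1,\quad \eta\circ\phi=0,\quad \phi\xi=0,\quad g(\phi X,\phi Y)=g(X,Y)-\eta(X)\eta(Y),\quad g(X,\phi Y)=-g(\phi X,Y),\quad g(X,\xi)=\eta(X).$$ Let $\alpha\in\mathbb{R}$ and suppose that the structure is $\alpha$-cosymplectic, i.e. with $\Phi(X,Y)=g(\phi X,Y)$, $$d\eta=0,\qquad d\Phi=2\alpha\,\eta\wedge\Phi,\qquad [\phi X,\phi Y]-\phi[\phi X,Y]-\phi[X,\phi Y]+\phi^2[X,Y]+2\,d\eta(X,Y)\,\xi=0$$ for all smooth vector fields $X,Y$. Let $\nabla$ be the Levi-Civita connection of $g$, and let $r$ be its scalar curvature, the trace of the Ricci tensor $S(Y,Z)=\operatorname{tr}\big(X\mapsto R(X,Y)Z\big)$, where $R(X,Y)Z=\nabla_X\nabla_YZ-\nabla_Y\nabla_XZ-\nabla_{[X,Y]}Z$.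 Let $\tilde\nabla$ be a quarter-symmetric metric connection on $M$, i.e. a smooth linear connection with $\tilde\nabla g=0$ and torsion $T(X,Y)=\eta(Y)\phi X-\eta(X)\phi Y$; let $\tilde R$ be its curvature tensor, defined by the same formula as $R$, and $\tilde S^{*}(Y,Z)=\tfrac12\operatorname{tr}\big(\phi\circ\tilde R(Y,\phi Z)\big)$ its $\ast$-Ricci tensor. For a vector field $V$ put $(\tilde{\pounds}_Vg)(X,Y)=g(\tilde\nabla_XV,Y)+g(X,\tilde\nabla_YV)$. Suppose that for real constants $\Lambda,\mu$ the metric is a $\ast$-$\eta$-Ricci soliton with respect to $\tilde\nabla$, that is, $$\tilde{\pounds}_\xi g+2\tilde S^{*}+2\Lambda g+2\mu\,\eta\otimes\eta=0$$ (the case $\rho=1$, $q=0$ of the $\ast$-$\eta$-Ricci-Yamabe soliton equation $\tilde{\pounds}_\xi g+2\rho\tilde S^{*}+[2\Lambda-q\tilde r^{*}]g+2\mu\,\eta\otimes\eta=0$, where $\tilde r^{*}$ is the trace of $\tilde S^{*}$). If $\xi=\operatorname{grad} f$ for a smooth function $f:M\to\mathbb{R}$, then $f$ satisfies at every point of $M$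 the Laplace equation $$\Delta f=-n\big[\Lambda+\alpha^2(n-2)\big]-\mu-(\alpha^2+r),$$ where $\Delta f=\operatorname{div}(\operatorname{grad} f)=\operatorname{tr}\big(X\mapsto\nabla_X\operatorname{grad} f\big)$. -/

import Mathlib

open Bundle
open scoped Manifold ContDiff

noncomputable section

namespace StarEtaSoliton

section Connections

variable {E : Type*} [NormedAddCommGroup E] [NormedSpace ℝ E] [FiniteDimensional ℝ E]
  {H : Type*} [TopologicalSpace H] {I : ModelWithCorners ℝ E H}
  {M : Type*} [TopologicalSpace M] [ChartedSpace H M] [IsManifold I ∞ M]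

/-- A linear connection on the tangent bundle. `cov Y x (X x)` is `(∇_X Y)(x)`. -/
abbrev LinearConnection (I : ModelWithCorners ℝ E H) (M : Type*) [TopologicalSpace M]
    [ChartedSpace H M] [IsManifold I ∞ M] :=
  CovariantDerivative I E (TangentSpace I : M → Type _)

/-- The curvature of a linear connection on vector fields,
`R(X, Y)Z = ∇_X ∇_Y Z - ∇_Y ∇_X Z - ∇_[X,Y] Z`. -/
def curvature (cov : LinearConnection I M) (X Y Z : Π x : M, TangentSpace I x) :
    Π x : M, TangentSpace I x := fun x ↦
  cov (fun y ↦ cov Z y (Y y)) x (X x) - cov (fun y ↦ cov Z y (X y)) x (Y x)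
    - cov Z x (VectorField.mlieBracket I X Y x)

/-- The curvature tensor at a point, on tangent vectors. For a smooth connection the value of
`curvature` at `x` depends only on the values at `x` of the three vector fields; here the vectors
are extended to vector fields that are smooth near `x` (constant in a local trivialization). -/
def curvatureAt (cov : LinearConnection I M) (x : M) (u v w : TangentSpace I x) :
    TangentSpace I x :=
  curvature cov (FiberBundle.extend E u) (FiberBundle.extend E v) (FiberBundle.extend E w) x

/-- The divergence of a vector field, `div X = trace (v ↦ ∇_v X)`. -/
def divergence (cov : LinearConnection I M) (X : Π x : M, TangentSpace I x) (x : M) : ℝ :=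
  LinearMap.trace ℝ (TangentSpace I x) (cov X x).toLinearMap

end Connections

section Riemannian

variable {E : Type*} [NormedAddCommGroup E] [NormedSpace ℝ E] [FiniteDimensional ℝ E]
  {H : Type*} [TopologicalSpace H] {I : ModelWithCorners ℝ E H}
  {M : Type*} [TopologicalSpace M] [ChartedSpace H M] [IsManifold I ∞ M]
  [RiemannianBundle (fun x : M ↦ TangentSpace I x)]

instance instFiniteDimensionalTangentSpace (x : M) : FiniteDimensional ℝ (TangentSpace I x) :=
  inferInstanceAs (FiniteDimensional ℝ E)

/-- An orthonormal basis of the tangent space at `x`, used for contractions. -/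
def frame (I : ModelWithCorners ℝ E H) (x : M) [RiemannianBundle (fun x : M ↦ TangentSpace I x)] :
    OrthonormalBasis (Fin (Module.finrank ℝ (TangentSpace I x))) ℝ (TangentSpace I x) :=
  stdOrthonormalBasis ℝ (TangentSpace I x)

/-- The Ricci tensor `S(v, w) = trace (u ↦ R(u, v)w)`. -/
def ricci (cov : LinearConnection I M) (x : M) (v w : TangentSpace I x) : ℝ :=
  ∑ i, inner ℝ (curvatureAt cov x (frame I x i) v w) (frame I x i)

/-- The scalar curvature, the trace of the Ricci tensor. -/
def scalarCurvature (cov : LinearConnection I M) (x : M) : ℝ :=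
  ∑ i, ricci cov x (frame I x i) (frame I x i)

/-- The `∗`-Ricci tensor `S*(v, w) = ½ trace (φ ∘ R(v, φ w))` of a connection, with respect to
an endomorphism field `φ`. -/
def starRicci (cov : LinearConnection I M) (φ : Π x : M, TangentSpace I x →L[ℝ] TangentSpace I x)
    (x : M) (v w : TangentSpace I x) : ℝ :=
  (1 / 2) * ∑ i, inner ℝ (φ x (curvatureAt cov x v (φ x w) (frame I x i))) (frame I x i)

/-- The `∗`-scalar curvature, the trace of the `∗`-Ricci tensor. -/
def starScalarCurvature (cov : LinearConnection I M)
    (φ : Π x : M, TangentSpace I x →L[ℝ] TangentSpace I x) (x : M) : ℝ :=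
  ∑ i, starRicci cov φ x (frame I x i) (frame I x i)

/-- The Lie derivative of the metric with respect to a metric connection,
`(£_V g)(u, v) = g(∇_u V, v) + g(u, ∇_v V)`. For the Levi-Civita connection this is the usual Lie
derivative of `g` along `V`. -/
def lieDerivMetric (cov : LinearConnection I M) (V : Π x : M, TangentSpace I x) (x : M)
    (u v : TangentSpace I x) : ℝ :=
  inner ℝ (cov V x u) v + inner ℝ u (cov V x v)

/-- The gradient of a function: `g(grad f, v) = df(v)`. -/
def grad (I : ModelWithCorners ℝ E H) [RiemannianBundle (fun x : M ↦ TangentSpace I x)]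
    (f : M → ℝ) (x : M) : TangentSpace I x :=
  (InnerProductSpace.toDual ℝ (TangentSpace I x)).symm (mvfderiv I f x)

/-- The Laplacian `Δf = div (grad f)`; `cov` is meant to be the Levi-Civita connection. -/
def laplacian (cov : LinearConnection I M) (f : M → ℝ) (x : M) : ℝ :=
  divergence cov (grad I f) x

/-- An almost contact metric structure `(φ, ξ, η, g)` on a manifold, where `g` is the ambient
Riemannian metric. -/
structure AlmostContactMetricStructure (I : ModelWithCorners ℝ E H) (M : Type*)
    [TopologicalSpace M] [ChartedSpace H M] [IsManifold I ∞ M]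
    [RiemannianBundle (fun x : M ↦ TangentSpace I x)] where
  /-- The `(1,1)`-tensor field. -/
  φ : Π x : M, TangentSpace I x →L[ℝ] TangentSpace I x
  /-- The vector field. -/
  ξ : Π x : M, TangentSpace I x
  /-- The 1-form. -/
  η : Π x : M, TangentSpace I x →L[ℝ] ℝ
  smooth_φ : ContMDiff I (I.prod 𝓘(ℝ, E →L[ℝ] E)) ∞
    (fun x ↦ TotalSpace.mk' (E →L[ℝ] E)
      (E := fun x : M ↦ TangentSpace I x →L[ℝ] TangentSpace I x) x (φ x))
  smooth_ξ : ContMDiff I I.tangent ∞ (fun x ↦ (⟨x, ξ x⟩ : TangentBundle I M))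
  smooth_η : ContMDiff I (I.prod 𝓘(ℝ, E →L[ℝ] ℝ)) ∞
    (fun x ↦ TotalSpace.mk' (E →L[ℝ] ℝ)
      (E := fun x : M ↦ TangentSpace I x →L[ℝ] Bundle.Trivial M ℝ x) x (η x))
  φ_φ : ∀ x (u : TangentSpace I x), φ x (φ x u) = -u + η x u • ξ x
  η_ξ : ∀ x, η x (ξ x) = 1
  η_φ : ∀ x (u : TangentSpace I x), η x (φ x u) = 0
  φ_ξ : ∀ x, φ x (ξ x) = 0
  inner_φ_φ : ∀ x (u v : TangentSpace I x),
    inner ℝ (φ x u) (φ x v) = inner ℝ u v - η x u * η x v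
  inner_φ_right : ∀ x (u v : TangentSpace I x), inner ℝ u (φ x v) = -inner ℝ (φ x u) v
  inner_ξ : ∀ x (u : TangentSpace I x), inner ℝ u (ξ x) = η x u

namespace AlmostContactMetricStructure

variable (S : AlmostContactMetricStructure I M)

/-- `dη(X, Y) = X(η(Y)) - Y(η(X)) - η([X, Y])`. -/
def dη (X Y : Π x : M, TangentSpace I x) (x : M) : ℝ :=
  mvfderiv I (fun y ↦ S.η y (Y y)) x (X x) - mvfderiv I (fun y ↦ S.η y (X y)) x (Y x)
    - S.η x (VectorField.mlieBracket I X Y x)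

/-- The fundamental 2-form `Φ(u, v) = g(φu, v)`. -/
def Φ (x : M) (u v : TangentSpace I x) : ℝ := inner ℝ (S.φ x u) v

/-- `dΦ(X, Y, Z)`, by the invariant formula for the exterior derivative of a 2-form. -/
def dΦ (X Y Z : Π x : M, TangentSpace I x) (x : M) : ℝ :=
  mvfderiv I (fun y ↦ S.Φ y (Y y) (Z y)) x (X x)
    + mvfderiv I (fun y ↦ S.Φ y (Z y) (X y)) x (Y x)
    + mvfderiv I (fun y ↦ S.Φ y (X y) (Y y)) x (Z x)
    - S.Φ x (VectorField.mlieBracket I X Y x) (Z x)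
    - S.Φ x (VectorField.mlieBracket I Y Z x) (X x)
    - S.Φ x (VectorField.mlieBracket I Z X x) (Y x)

/-- `(η ∧ Φ)(u, v, w)`. -/
def ηwedgeΦ (x : M) (u v w : TangentSpace I x) : ℝ :=
  S.η x u * S.Φ x v w + S.η x v * S.Φ x w u + S.η x w * S.Φ x u v

/-- The normality tensor
`N(X, Y) = [φX, φY] - φ[φX, Y] - φ[X, φY] + φ²[X, Y] + 2 dη(X, Y) ξ`. -/
def normalityTensor (X Y : Π x : M, TangentSpace I x) (x : M) : TangentSpace I x :=
  VectorField.mlieBracket I (fun y ↦ S.φ y (X y)) (fun y ↦ S.φ y (Y y)) x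
    - S.φ x (VectorField.mlieBracket I (fun y ↦ S.φ y (X y)) Y x)
    - S.φ x (VectorField.mlieBracket I X (fun y ↦ S.φ y (Y y)) x)
    + S.φ x (S.φ x (VectorField.mlieBracket I X Y x))
    + (2 * S.dη X Y x) • S.ξ x

/-- A vector field is smooth at `x`. The tensorial identities below are required at every point
for all vector fields smooth at that point; by cutting off this is the same as requiring them for
all globally smooth vector fields. -/
def SmoothAt (X : Π x : M, TangentSpace I x) (x : M) : Prop :=
  ContMDiffAt I I.tangent ∞ (fun y ↦ (⟨y, X y⟩ : TangentBundle I M)) x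

/-- An `α`-cosymplectic structure: a normal almost contact metric structure with `dη = 0` and
`dΦ = 2α η ∧ Φ`, where `α` is a real number. -/
structure IsAlphaCosymplectic (α : ℝ) : Prop where
  dη_eq_zero : ∀ x X Y, SmoothAt (I := I) X x → SmoothAt Y x → S.dη X Y x = 0
  dΦ_eq : ∀ x X Y Z, SmoothAt (I := I) X x → SmoothAt Y x → SmoothAt Z x →
    S.dΦ X Y Z x = 2 * α * S.ηwedgeΦ x (X x) (Y x) (Z x)
  normal : ∀ x X Y, SmoothAt (I := I) X x → SmoothAt Y x → S.normalityTensor X Y x = 0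

/-- The connection `cov` makes `(M, φ, ξ, η, g)` a `∗`-`η`-Ricci–Yamabe soliton of type `(ρ, q)`
with constants `Λ`, `μ`: `£_ξ g + 2ρ S* + [2Λ - q r*] g + 2μ η ⊗ η = 0`, where the Lie derivative,
the `∗`-Ricci tensor and the `∗`-scalar curvature are those of `cov`. -/
def IsStarEtaRicciYamabeSoliton (cov : LinearConnection I M) (ρ q Λ μ : ℝ) : Prop :=
  ∀ (x : M) (u v : TangentSpace I x),
    lieDerivMetric cov S.ξ x u v + 2 * ρ * starRicci cov S.φ x u v
      + (2 * Λ - q * starScalarCurvature cov S.φ x) * inner ℝ u v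
      + 2 * μ * (S.η x u * S.η x v) = 0

/-- A `∗`-`η`-Ricci soliton with respect to `cov`: the case `ρ = 1`, `q = 0`, i.e.
`£_ξ g + 2 S* + 2Λ g + 2μ η ⊗ η = 0`. -/
def IsStarEtaRicciSoliton (cov : LinearConnection I M) (Λ μ : ℝ) : Prop :=
  S.IsStarEtaRicciYamabeSoliton cov 1 0 Λ μ

end AlmostContactMetricStructure

variable [IsContMDiffRiemannianBundle I ∞ E (fun x : M ↦ TangentSpace I x)]

/-- The Levi-Civita connection: smooth, metric and torsion-free. -/
structure IsLeviCivita (cov : LinearConnection I M) : Prop where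
  smooth : CovariantDerivative.ContMDiffCovariantDerivative cov ∞
  metric : CovariantDerivative.IsMetricCompatible (V := fun x : M ↦ TangentSpace I x) cov
  torsion_eq_zero : cov.torsion = 0

/-- A quarter-symmetric metric connection: smooth, metric, and with torsion
`T(X, Y) = η(Y) φX - η(X) φY`. -/
structure IsQuarterSymmetricMetric (S : AlmostContactMetricStructure I M)
    (cov : LinearConnection I M) : Prop where
  smooth : CovariantDerivative.ContMDiffCovariantDerivative cov ∞
  metric : CovariantDerivative.IsMetricCompatible (V := fun x : M ↦ TangentSpace I x) cov
  torsion_eq : ∀ (x : M) (u v : TangentSpace I x),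
    cov.torsion x u v = S.η x v • S.φ x u - S.η x u • S.φ x v

end Riemannian

end StarEtaSoliton

end

/-!
The quarter-symmetric metric connection is `∇̃ = ∇ - η ⊗ φ`, since a metric connection is determined
by its torsion (`IsQuarterSymmetricMetric.cov_apply`). It differentiates `ξ` as `∇` does, because
`φ ξ = 0`, so tracing the soliton equation gives `div ξ + tr S̃* + n Λ + μ = 0`, where
`div ξ = Δf`. It remains to compute `S̃*`.

On an `α`-cosymplectic manifold `(∇_X φ)Y = α (g(φX, Y) ξ - η(Y) φX)` and `∇_X ξ = α (X - η(X) ξ)`.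
With `∇` torsion-free and metric, the conditions on `dη`, `dΦ` and the normality tensor become
algebraic identities for `∇φ` and `∇ξ` at a point; these two formulas satisfy them, and
`IsAlmostContact.eq_zero_of_cosymplectic` shows that they have at most one solution.
Differentiating once more gives `R(X, Y)ξ`, the commutator of `R(X, Y)` with `φ`, and the difference
of the curvatures of `∇̃` and `∇`. The extra terms in `R̃` do not contribute to the trace defining
`S̃*`, and the first Bianchi identity converts that trace into the Ricci tensor:
`S̃* = S + α² ((n - 2) g + η ⊗ η)` (`IsCurvatureLike.starRicci_eq`), whose trace is
`r + α² (n (n - 2) + 1)`.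

All computations are made with globally smooth vector fields, which exist through any tangent vector
by a cutoff; the curvature at a point does not depend on their choice (`curvatureAt_apply`). The two
facts about second derivatives that enter, the first Bianchi identity and the skew-symmetry of the
curvature endomorphisms, both come from the Jacobi identity for the Lie bracket.
-/

noncomputable section

set_option linter.unusedSectionVars false

open Filter FiberBundle VectorField
open scoped Topology

namespace StarEtaSoliton

/-! ### Smooth vector fields -/

section SmoothFields

variable {E : Type*} [NormedAddCommGroup E] [NormedSpace ℝ E] [FiniteDimensional ℝ E]
  {H : Type*} [TopologicalSpace H] {I : ModelWithCorners ℝ E H}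
  {M : Type*} [TopologicalSpace M] [ChartedSpace H M] [IsManifold I ∞ M]

/-- A globally smooth vector field. -/
def IsSmoothField (X : Π x : M, TangentSpace I x) : Prop :=
  ContMDiff I I.tangent ∞ (fun x ↦ (⟨x, X x⟩ : TangentBundle I M))

namespace IsSmoothField

variable {X Y Z : Π x : M, TangentSpace I x}

lemma mdifferentiableAt (hX : IsSmoothField X) (x : M) :
    MDifferentiableAt I I.tangent (fun x ↦ (⟨x, X x⟩ : TangentBundle I M)) x :=
  (hX x).mdifferentiableAt (by simp)

lemma add (hX : IsSmoothField X) (hY : IsSmoothField Y) : IsSmoothField (X + Y) :=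
  ContMDiff.add_section hX hY

lemma sub (hX : IsSmoothField X) (hY : IsSmoothField Y) : IsSmoothField (X - Y) :=
  ContMDiff.sub_section hX hY

lemma smul {f : M → ℝ} (hf : ContMDiff I 𝓘(ℝ, ℝ) ∞ f) (hX : IsSmoothField X) :
    IsSmoothField (f • X) :=
  ContMDiff.smul_section hf hX

lemma const_smul (c : ℝ) (hX : IsSmoothField X) : IsSmoothField (c • X) :=
  ContMDiff.const_smul_section hX

lemma mlieBracket (hX : IsSmoothField X) (hY : IsSmoothField Y) :
    IsSmoothField (mlieBracket I X Y) := by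
  have : IsManifold I (((⊤ : ℕ∞) : WithTop ℕ∞) + 1) M := inferInstanceAs (IsManifold I ∞ M)
  have : IsManifold I (minSmoothness ℝ 2) M := by
    simp only [minSmoothness_of_isRCLikeNormedField]; infer_instance
  exact ContDiff.mlieBracket_vectorField (n := ⊤) (m := ⊤) hX hY (by simp)

end IsSmoothField

/-- Every tangent vector extends to a globally smooth vector field with the same germ as
`FiberBundle.extend`, by cutting the latter off with a bump function. -/
lemma exists_isSmoothField_eventuallyEq_extend [T2Space M] (x : M) (v : TangentSpace I x) :
    ∃ V : Π x : M, TangentSpace I x, IsSmoothField V ∧ V x = v ∧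
      ∀ᶠ y in 𝓝 x, extend E v y = V y := by
  obtain ⟨s, hs, hsmooth⟩ :=
    exists_contMDiffOn_extend (k := ∞) I E (V := (TangentSpace I : M → Type _)) v
  obtain ⟨t, hts, hto, hxt⟩ := mem_nhds_iff.mp hs
  obtain ⟨ψ, hψ⟩ := (SmoothBumpFunction.nhds_basis_tsupport (I := I) x).mem_iff.mp
    (hto.mem_nhds hxt)
  have heq : ∀ᶠ y in 𝓝 x, extend E v y = ((ψ : M → ℝ) • extend E v) y := by
    filter_upwards [ψ.eventuallyEq_one] with y hy
    simp [hy]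
  refine ⟨(ψ : M → ℝ) • extend E v, ?_, ?_, heq⟩
  · exact ContMDiffOn.smul_section_of_tsupport ψ.contMDiff.contMDiffOn hto hψ.2
      (hsmooth.mono hts)
  · simp

lemma exists_isSmoothField_apply_eq [T2Space M] (x : M) (v : TangentSpace I x) :
    ∃ V : Π x : M, TangentSpace I x, IsSmoothField V ∧ V x = v :=
  let ⟨V, hV, hVx, _⟩ := exists_isSmoothField_eventuallyEq_extend x v
  ⟨V, hV, hVx⟩

/-- `X (Y f) - Y (X f) = [X, Y] f`, deduced from the Jacobi identity for `X`, `Y` and `f V`, where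
`V` does not vanish at the point. -/
lemma mvfderiv_mlieBracket [T2Space M] {X Y : Π x : M, TangentSpace I x} (hX : IsSmoothField X)
    (hY : IsSmoothField Y) {f : M → ℝ} (hf : ContMDiff I 𝓘(ℝ, ℝ) ∞ f)
    (hXf : ContMDiff I 𝓘(ℝ, ℝ) ∞ (fun y ↦ mvfderiv I f y (X y)))
    (hYf : ContMDiff I 𝓘(ℝ, ℝ) ∞ (fun y ↦ mvfderiv I f y (Y y))) (x : M) :
    mvfderiv I (fun y ↦ mvfderiv I f y (Y y)) x (X x)
      - mvfderiv I (fun y ↦ mvfderiv I f y (X y)) x (Y x)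
      = mvfderiv I f x (mlieBracket I X Y x) := by
  have hmd {g : M → ℝ} (hg : ContMDiff I 𝓘(ℝ, ℝ) ∞ g) (y : M) : MDifferentiableAt I 𝓘(ℝ, ℝ) g y :=
    (hg y).mdifferentiableAt (by simp)
  -- In dimension `0` there is no field that does not vanish at `x`, but both sides are zero.
  by_cases hsub : ∀ v : TangentSpace I x, v = 0
  · rw [hsub (X x), hsub (Y x), hsub (mlieBracket I X Y x)]
    simp
  push Not at hsub
  obtain ⟨v, hv⟩ := hsub
  obtain ⟨V, hV, rfl⟩ := exists_isSmoothField_apply_eq x v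
  have hbr {U : Π x : M, TangentSpace I x} :
      mlieBracket I U (f • V) = (fun y ↦ mvfderiv I f y (U y)) • V + f • mlieBracket I U V := by
    ext1 y
    exact mlieBracket_smul_right (hmd hf y) (hV.mdifferentiableAt y)
  have hexp {U W : Π x : M, TangentSpace I x} (hW : IsSmoothField W)
      (hWf : ContMDiff I 𝓘(ℝ, ℝ) ∞ (fun y ↦ mvfderiv I f y (W y))) :
      mlieBracket I U (mlieBracket I W (f • V)) x
        = mvfderiv I (fun y ↦ mvfderiv I f y (W y)) x (U x) • V x
          + mvfderiv I f x (W x) • mlieBracket I U V x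
          + (mvfderiv I f x (U x) • mlieBracket I W V x
            + f x • mlieBracket I U (mlieBracket I W V) x) := by
    rw [hbr, mlieBracket_add_right, mlieBracket_smul_right (hmd hWf x) (hV.mdifferentiableAt x),
      mlieBracket_smul_right (hmd hf x) ((hW.mlieBracket hV).mdifferentiableAt x)]
    · exact (IsSmoothField.smul hWf hV).mdifferentiableAt x
    · exact (IsSmoothField.smul hf (hW.mlieBracket hV)).mdifferentiableAt x
  have : IsManifold I (minSmoothness ℝ 3) M := by
    simp only [minSmoothness_of_isRCLikeNormedField]; infer_instance
  have hle {U : Π x : M, TangentSpace I x} (hU : IsSmoothField U) :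
      ContMDiffAt I I.tangent (minSmoothness ℝ 2) (fun x ↦ (⟨x, U x⟩ : TangentBundle I M)) x :=
    (hU x).of_le (by
      simp only [minSmoothness_of_isRCLikeNormedField]; exact WithTop.coe_le_coe.mpr le_top)
  have h₁ := leibniz_identity_mlieBracket_apply (hle hX) (hle hY) (hle (IsSmoothField.smul hf hV))
  have h₂ := leibniz_identity_mlieBracket_apply (hle hX) (hle hY) (hle hV)
  rw [hexp hY hYf, hexp hX hXf, hbr, h₂] at h₁
  simp only [Pi.add_apply, Pi.smul_apply', smul_add] at h₁
  have h₃ : (mvfderiv I (fun y ↦ mvfderiv I f y (Y y)) x (X x)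
      - mvfderiv I (fun y ↦ mvfderiv I f y (X y)) x (Y x)
      - mvfderiv I f x (mlieBracket I X Y x)) • V x = 0 := by
    rw [sub_smul, sub_smul]
    linear_combination (norm := module) h₁
  exact sub_eq_zero.mp ((smul_eq_zero.mp h₃).resolve_right hv)

end SmoothFields

/-! ### Curvature of a connection -/

section Connections

variable {E : Type*} [NormedAddCommGroup E] [NormedSpace ℝ E] [FiniteDimensional ℝ E]
  {H : Type*} [TopologicalSpace H] {I : ModelWithCorners ℝ E H}
  {M : Type*} [TopologicalSpace M] [ChartedSpace H M] [IsManifold I ∞ M]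
  {cov : LinearConnection I M} {X Y Z W : Π x : M, TangentSpace I x}

lemma contMDiff_cov (hcov : CovariantDerivative.ContMDiffCovariantDerivative cov ∞)
    (hY : IsSmoothField Y) :
    ContMDiff I (I.prod 𝓘(ℝ, E →L[ℝ] E)) ∞
      (fun x ↦ TotalSpace.mk' (E →L[ℝ] E)
        (E := fun x : M ↦ TangentSpace I x →L[ℝ] TangentSpace I x) x (cov Y x)) :=
  contMDiffOn_univ.mp (hcov.contMDiff.contMDiff (contMDiffOn_univ.mpr hY))

lemma IsSmoothField.covariantDerivative
    (hcov : CovariantDerivative.ContMDiffCovariantDerivative cov ∞)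
    (hY : IsSmoothField Y) (hX : IsSmoothField X) :
    IsSmoothField (fun y ↦ cov Y y (X y)) := by
  exact ContMDiff.clm_bundle_apply (contMDiff_cov hcov hY) hX

lemma cov_add_apply (hX : IsSmoothField X) (hY : IsSmoothField Y) (x : M) (v : TangentSpace I x) :
    cov (X + Y) x v = cov X x v + cov Y x v := by
  rw [cov.isCovariantDerivativeOnUniv.add (hX.mdifferentiableAt x) (hY.mdifferentiableAt x)]
  rfl

lemma cov_smul_apply {f : M → ℝ} (hf : ContMDiff I 𝓘(ℝ, ℝ) ∞ f) (hY : IsSmoothField Y) (x : M)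
    (v : TangentSpace I x) :
    cov (f • Y) x v = f x • cov Y x v + mvfderiv I f x v • Y x := by
  rw [cov.isCovariantDerivativeOnUniv.leibniz (hY.mdifferentiableAt x)
    ((hf x).mdifferentiableAt (by simp))]
  rfl

lemma cov_const_smul_apply (c : ℝ) (hY : IsSmoothField Y) (x : M) (v : TangentSpace I x) :
    cov (c • Y) x v = c • cov Y x v := by
  rw [cov.isCovariantDerivativeOnUniv.smul_const c (hY.mdifferentiableAt x)]
  rfl

lemma cov_sub_apply (hX : IsSmoothField X) (hY : IsSmoothField Y) (x : M) (v : TangentSpace I x) :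
    cov (X - Y) x v = cov X x v - cov Y x v := by
  have h : X - Y = X + (-1 : ℝ) • Y := by module
  rw [h, cov_add_apply hX (hY.const_smul _), cov_const_smul_apply _ hY]
  module

/-- A torsion-free connection computes the Lie bracket. -/
lemma cov_sub_cov_of_torsion_eq_zero (hcov : cov.torsion = 0) (hX : IsSmoothField X)
    (hY : IsSmoothField Y) (x : M) :
    cov Y x (X x) - cov X x (Y x) = mlieBracket I X Y x :=
  cov.torsion_eq_zero_iff.mp hcov (hX.mdifferentiableAt x) (hY.mdifferentiableAt x)

lemma curvature_swap (x : M) : curvature cov X Y Z x = -curvature cov Y X Z x := by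
  simp only [curvature]
  rw [mlieBracket_swap_apply, map_neg]
  abel

/-- The curvature is tensorial in its first argument. -/
lemma tensorialAt_curvature (hcov : CovariantDerivative.ContMDiffCovariantDerivative cov ∞)
    (hZ : IsSmoothField Z) (x : M) :
    TensorialAt I E (fun X ↦ curvature cov X Y Z x) x where
  smul {f X} hf hX := by
    have hcX := MDifferentiableAt.clm_bundle_apply
      ((contMDiff_cov hcov hZ x).mdifferentiableAt (by simp)) hX
    have h₁ : (fun y ↦ cov Z y ((f • X) y)) = f • fun y ↦ cov Z y (X y) := by
      ext1 y; simp
    simp only [curvature]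
    rw [h₁, cov.isCovariantDerivativeOnUniv.leibniz hcX hf, mlieBracket_smul_left hf hX]
    simp only [Pi.smul_apply', map_smul, map_add, map_neg, add_apply,
      smul_apply, ContinuousLinearMap.smulRight_apply, neg_smul]
    module
  add {X X'} hX hX' := by
    have hc {U : Π x : M, TangentSpace I x} (hU) := MDifferentiableAt.clm_bundle_apply
      (v := U) ((contMDiff_cov hcov hZ x).mdifferentiableAt (by simp)) hU
    have h₁ : (fun y ↦ cov Z y ((X + X') y))
        = (fun y ↦ cov Z y (X y)) + fun y ↦ cov Z y (X' y) := by
      ext1 y; simp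
    simp only [curvature]
    rw [h₁, cov.isCovariantDerivativeOnUniv.add (hc hX) (hc hX'), mlieBracket_add_left hX hX']
    simp only [Pi.add_apply, map_add, add_apply]
    module

/-- The curvature depends only on the germs of its arguments. -/
lemma curvature_congr (hcov : CovariantDerivative.ContMDiffCovariantDerivative cov ∞)
    (hX : IsSmoothField X) (hY : IsSmoothField Y) (hZ : IsSmoothField Z) {x : M}
    {X' Y' Z' : Π x : M, TangentSpace I x} (hX' : ∀ᶠ y in 𝓝 x, X' y = X y)
    (hY' : ∀ᶠ y in 𝓝 x, Y' y = Y y) (hZ' : ∀ᶠ y in 𝓝 x, Z' y = Z y) :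
    curvature cov X' Y' Z' x = curvature cov X Y Z x := by
  have hcong {U V : Π x : M, TangentSpace I x} {y : M} (hU : IsSmoothField U)
      (hVU : ∀ᶠ z in 𝓝 y, V z = U z) : cov V y = cov U y := by
    refine cov.isCovariantDerivativeOnUniv.congr_of_eventuallyEq ?_ (hU.mdifferentiableAt y)
      univ_mem hVU
    refine (hU.mdifferentiableAt y).congr_of_eventuallyEq ?_
    filter_upwards [hVU] with z hz
    rw [hz]
  have hcong₂ {U V : Π x : M, TangentSpace I x} (hU : IsSmoothField U)
      (hVU : ∀ᶠ z in 𝓝 x, V z = U z) :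
      cov (fun y ↦ cov Z' y (V y)) x = cov (fun y ↦ cov Z y (U y)) x := by
    refine hcong (hZ.covariantDerivative hcov hU) ?_
    filter_upwards [eventually_eventually_nhds.mpr hZ', hVU] with y hy hVy
    rw [hcong hZ hy, hVy]
  simp only [curvature]
  rw [hcong₂ hX hX', hcong₂ hY hY', hcong hZ hZ', hX'.self_of_nhds, hY'.self_of_nhds,
    EventuallyEq.mlieBracket_vectorField_eq hX' hY']

/-- The first Bianchi identity, a consequence of the Jacobi identity. -/
lemma curvature_bianchi (hcov : CovariantDerivative.ContMDiffCovariantDerivative cov ∞)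
    (htor : cov.torsion = 0) (hX : IsSmoothField X) (hY : IsSmoothField Y) (hZ : IsSmoothField Z)
    (x : M) :
    curvature cov X Y Z x + curvature cov Y Z X x + curvature cov Z X Y x = 0 := by
  have hbr {U V : Π x : M, TangentSpace I x} (hU : IsSmoothField U) (hV : IsSmoothField V) :
      (fun y ↦ cov V y (U y)) = (fun y ↦ cov U y (V y)) + mlieBracket I U V := by
    ext1 y
    rw [Pi.add_apply, ← cov_sub_cov_of_torsion_eq_zero htor hU hV y]
    abel
  have : IsManifold I (minSmoothness ℝ 3) M := by
    simp only [minSmoothness_of_isRCLikeNormedField]; infer_instance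
  have hle {U : Π x : M, TangentSpace I x} (hU : IsSmoothField U) :
      ContMDiffAt I I.tangent (minSmoothness ℝ 2) (fun x ↦ (⟨x, U x⟩ : TangentBundle I M)) x :=
    (hU x).of_le (by
      simp only [minSmoothness_of_isRCLikeNormedField]; exact WithTop.coe_le_coe.mpr le_top)
  -- Torsion-freeness turns the cyclic sum into `[X, [Y, Z]] - [Y, [X, Z]] - [[X, Y], Z]`.
  have hjac := leibniz_identity_mlieBracket_apply (hle hX) (hle hY) (hle hZ)
  have h₁ := cov_sub_cov_of_torsion_eq_zero htor hX (hY.mlieBracket hZ) x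
  have h₂ := cov_sub_cov_of_torsion_eq_zero htor hY (hX.mlieBracket hZ) x
  have h₃ := cov_sub_cov_of_torsion_eq_zero htor (hX.mlieBracket hY) hZ x
  have hZX : mlieBracket I Z X x = -mlieBracket I X Z x := mlieBracket_swap_apply
  simp only [curvature]
  rw [hbr hY hZ, hbr hX hZ, hbr hX hY,
    cov_add_apply (hY.covariantDerivative hcov hZ) (hY.mlieBracket hZ),
    cov_add_apply (hX.covariantDerivative hcov hZ) (hX.mlieBracket hZ),
    cov_add_apply (hX.covariantDerivative hcov hY) (hX.mlieBracket hY), hZX, map_neg]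
  linear_combination (norm := module) hjac + h₁ - h₂ - h₃

end Connections


/-! ### Metric connections -/

section Metric

variable {E : Type*} [NormedAddCommGroup E] [NormedSpace ℝ E] [FiniteDimensional ℝ E]
  {H : Type*} [TopologicalSpace H] {I : ModelWithCorners ℝ E H}
  {M : Type*} [TopologicalSpace M] [ChartedSpace H M] [IsManifold I ∞ M]
  [RiemannianBundle (fun x : M ↦ TangentSpace I x)]
  [IsContMDiffRiemannianBundle I ∞ E (fun x : M ↦ TangentSpace I x)]
  {cov : LinearConnection I M} {X Y Z W : Π x : M, TangentSpace I x}

lemma IsSmoothField.inner (hX : IsSmoothField X) (hY : IsSmoothField Y) :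
    ContMDiff I 𝓘(ℝ, ℝ) ∞ (fun y ↦ inner ℝ (X y) (Y y)) :=
  ContMDiff.inner_bundle hX hY

lemma mvfderiv_inner
    (hcov : CovariantDerivative.IsMetricCompatible (V := fun x : M ↦ TangentSpace I x) cov)
    (hX : IsSmoothField X) (hY : IsSmoothField Y) (x : M) (v : TangentSpace I x) :
    mvfderiv I (fun y ↦ inner ℝ (X y) (Y y)) x v
      = inner ℝ (cov X x v) (Y x) + inner ℝ (X x) (cov Y x v) := by
  have h := hcov.mvfderiv_inner_eq (extend E v) (hX.mdifferentiableAt x) (hY.mdifferentiableAt x)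
  simpa using h

variable [T2Space M]

/-- The curvature endomorphisms of a metric connection are skew-symmetric: second derivatives of
`g(Z, W)` commute up to the Lie bracket. -/
lemma inner_curvature_add (hcov : CovariantDerivative.ContMDiffCovariantDerivative cov ∞)
    (hmet : CovariantDerivative.IsMetricCompatible (V := fun x : M ↦ TangentSpace I x) cov)
    (hX : IsSmoothField X) (hY : IsSmoothField Y) (hZ : IsSmoothField Z) (hW : IsSmoothField W)
    (x : M) :
    inner ℝ (curvature cov X Y Z x) (W x) + inner ℝ (Z x) (curvature cov X Y W x) = 0 := by
  have hder (U : Π x : M, TangentSpace I x) :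
      (fun y ↦ mvfderiv I (fun z ↦ inner ℝ (Z z) (W z)) y (U y))
        = fun y ↦ inner ℝ (cov Z y (U y)) (W y) + inner ℝ (Z y) (cov W y (U y)) := by
    ext1 y
    exact mvfderiv_inner hmet hZ hW y (U y)
  have hsm {U : Π x : M, TangentSpace I x} (hU : IsSmoothField U) :
      ContMDiff I 𝓘(ℝ, ℝ) ∞ (fun y ↦ mvfderiv I (fun z ↦ inner ℝ (Z z) (W z)) y (U y)) := by
    rw [hder]
    exact ((hZ.covariantDerivative hcov hU).inner hW).add
      (hZ.inner (hW.covariantDerivative hcov hU))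
  have hsecond {U V : Π x : M, TangentSpace I x} (hU : IsSmoothField U) :
      mvfderiv I (fun y ↦ mvfderiv I (fun z ↦ inner ℝ (Z z) (W z)) y (U y)) x (V x)
        = (inner ℝ (cov (fun y ↦ cov Z y (U y)) x (V x)) (W x)
          + inner ℝ (cov Z x (U x)) (cov W x (V x)))
          + (inner ℝ (cov Z x (V x)) (cov W x (U x))
          + inner ℝ (Z x) (cov (fun y ↦ cov W y (U y)) x (V x))) := by
    rw [hder, mvfderiv_fun_add, add_apply,
      mvfderiv_inner hmet (hZ.covariantDerivative hcov hU) hW,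
      mvfderiv_inner hmet hZ (hW.covariantDerivative hcov hU)]
    · exact ((hZ.covariantDerivative hcov hU).inner hW x).mdifferentiableAt (by simp)
    · exact (hZ.inner (hW.covariantDerivative hcov hU) x).mdifferentiableAt (by simp)
  have h := mvfderiv_mlieBracket hX hY (hZ.inner hW) (hsm hX) (hsm hY) x
  rw [hsecond hX, hsecond hY, mvfderiv_inner hmet hZ hW] at h
  simp only [curvature, inner_sub_left, inner_sub_right]
  linear_combination h

/-- The value at a point of the curvature of a smooth metric connection, computed with arbitrary
smooth extensions of the tangent vectors. -/
lemma curvatureAt_apply (hcov : CovariantDerivative.ContMDiffCovariantDerivative cov ∞)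
    (hmet : CovariantDerivative.IsMetricCompatible (V := fun x : M ↦ TangentSpace I x) cov)
    (hX : IsSmoothField X) (hY : IsSmoothField Y) (hZ : IsSmoothField Z) (x : M) :
    curvatureAt cov x (X x) (Y x) (Z x) = curvature cov X Y Z x := by
  obtain ⟨X', hX', hXx, hXe⟩ := exists_isSmoothField_eventuallyEq_extend x (X x)
  obtain ⟨Y', hY', hYx, hYe⟩ := exists_isSmoothField_eventuallyEq_extend x (Y x)
  obtain ⟨Z', hZ', hZx, hZe⟩ := exists_isSmoothField_eventuallyEq_extend x (Z x)
  have h₁ {U V : Π x : M, TangentSpace I x} (hV : IsSmoothField V) :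
      curvature cov X' U V x = curvature cov X U V x :=
    (tensorialAt_curvature hcov hV x).pointwise (hX'.mdifferentiableAt x)
      (hX.mdifferentiableAt x) hXx
  have h₂ {U : Π x : M, TangentSpace I x} (hU : IsSmoothField U) :
      curvature cov X Y' U x = curvature cov X Y U x := by
    rw [curvature_swap, curvature_swap (X := X), (tensorialAt_curvature hcov hU x).pointwise
      (hY'.mdifferentiableAt x) (hY.mdifferentiableAt x) hYx]
  rw [curvatureAt, curvature_congr hcov hX' hY' hZ' hXe hYe hZe, h₁ hZ', h₂ hZ']
  -- Skew-symmetry moves the curvature off its last argument, so only the value at `x` matters.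
  refine ext_inner_right ℝ fun w ↦ ?_
  obtain ⟨W, hW, rfl⟩ := exists_isSmoothField_apply_eq x w
  have h₃ := inner_curvature_add hcov hmet hX hY hZ hW x
  have h₄ := inner_curvature_add hcov hmet hX hY hZ' hW x
  rw [hZx] at h₄
  linarith

end Metric

/-! ### Linear algebra of almost contact structures -/

section AlmostContactAlgebra

variable {V : Type*} [NormedAddCommGroup V] [InnerProductSpace ℝ V]

/-- The algebraic identities of an almost contact metric structure on one tangent space. -/
structure IsAlmostContact (φ : V →L[ℝ] V) (ξ : V) (η : V →L[ℝ] ℝ) : Prop where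
  φ_φ : ∀ u, φ (φ u) = -u + η u • ξ
  η_ξ : η ξ = 1
  η_φ : ∀ u, η (φ u) = 0
  φ_ξ : φ ξ = 0
  inner_φ_right : ∀ u v, inner ℝ u (φ v) = -inner ℝ (φ u) v
  inner_ξ : ∀ u, inner ℝ u ξ = η u

namespace IsAlmostContact

variable {φ : V →L[ℝ] V} {ξ : V} {η : V →L[ℝ] ℝ}

lemma inner_ξ_left (hφ : IsAlmostContact φ ξ η) (u : V) : inner ℝ ξ u = η u := by
  rw [real_inner_comm, hφ.inner_ξ]

lemma inner_φ_φ (hφ : IsAlmostContact φ ξ η) (u v : V) :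
    inner ℝ (φ u) (φ v) = inner ℝ u v - η u * η v := by
  rw [hφ.inner_φ_right, hφ.φ_φ, inner_add_left, inner_neg_left, real_inner_smul_left,
    hφ.inner_ξ_left]
  ring

lemma inner_φ_self (hφ : IsAlmostContact φ ξ η) (u : V) : inner ℝ (φ u) u = 0 := by
  have h := hφ.inner_φ_right u u
  rw [real_inner_comm] at h
  linarith

/-- If `D` has the algebraic symmetries of `∇φ` and `h` those of `∇ξ` on a normal structure with
`dη = 0` and `dΦ = 0`, then both vanish. -/
lemma eq_zero_of_cosymplectic (hφ : IsAlmostContact φ ξ η) {D : V →ₗ[ℝ] V →ₗ[ℝ] V}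
    {h : V →ₗ[ℝ] V}
    (hskew : ∀ u v w, inner ℝ (D u v) w + inner ℝ v (D u w) = 0)
    (hcyc : ∀ u v w, inner ℝ (D u v) w + inner ℝ (D v w) u + inner ℝ (D w u) v = 0)
    (hnormal : ∀ u v, D (φ u) v - D (φ v) u + φ (D v u) - φ (D u v) = 0)
    (hsq : ∀ u v, D u (φ v) + φ (D u v) = inner ℝ (h u) v • ξ + η v • h u)
    (hsymm : ∀ u v, inner ℝ (h u) v = inner ℝ (h v) u)
    (hη : ∀ u, η (h u) = 0) (hξ : ∀ u, D u ξ = -φ (h u)) :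
    (∀ u v, D u v = 0) ∧ ∀ u, h u = 0 := by
  have hskew' (u v w : V) : inner ℝ (D u w) v = -inner ℝ (D u v) w := by
    rw [real_inner_comm]; linarith [hskew u v w]
  have hN (u v w : V) : inner ℝ (D (φ u) v) w - inner ℝ (D (φ v) u) w
      - inner ℝ (D v u) (φ w) + inner ℝ (D u v) (φ w) = 0 := by
    have := congrArg (inner ℝ · w) (hnormal u v)
    simp only [inner_add_left, inner_sub_left, inner_zero_left] at this
    rw [hφ.inner_φ_right, hφ.inner_φ_right]
    linarith
  have hPξ (u w : V) : inner ℝ (D u ξ) w = inner ℝ (h u) (φ w) := by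
    rw [hξ, inner_neg_left, hφ.inner_φ_right]
  have hhξ (u : V) : inner ℝ (h ξ) u = 0 := by
    rw [hsymm, hφ.inner_ξ, hη]
  have hhξ' (u : V) : inner ℝ (h u) ξ = 0 := by
    rw [hφ.inner_ξ, hη]
  -- Evaluating the normality and the cyclic identity on `ξ` shows that `h` vanishes.
  have hhφ (v w : V) : inner ℝ (h (φ v)) (φ w) = 0 := by
    have h₁ := hN ξ v w
    have h₂ := hcyc ξ v (φ w)
    rw [hφ.φ_ξ, map_zero, LinearMap.zero_apply, inner_zero_left, hPξ, hPξ, hφ.φ_φ, inner_add_right,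
      inner_neg_right, real_inner_smul_right, hhξ'] at h₁
    rw [hskew' v ξ (φ w), hPξ, hPξ, hφ.φ_φ, inner_add_right, inner_neg_right, real_inner_smul_right,
      hhξ', hsymm (φ w) (φ v)] at h₂
    linarith
  have hh (u : V) : h u = 0 := by
    refine ext_inner_right ℝ fun w ↦ ?_
    have h₁ := hhφ (φ u) (φ w)
    rw [hφ.φ_φ, hφ.φ_φ, map_add, map_neg, map_smul] at h₁
    simp only [inner_add_left, inner_add_right, inner_neg_left, inner_neg_right,
      real_inner_smul_left, real_inner_smul_right, hhξ, hhξ'] at h₁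
    rw [inner_zero_left]
    linarith
  have hξr (u : V) : D u ξ = 0 := by rw [hξ, hh, map_zero, neg_zero]
  have hφD (u v w : V) : inner ℝ (D u (φ v)) w = inner ℝ (D u v) (φ w) := by
    have h₁ := congrArg (inner ℝ · w) (hsq u v)
    simp only [hh, inner_zero_left, zero_smul, smul_zero, add_zero, inner_add_left] at h₁
    rw [hφ.inner_φ_right]
    linarith
  have hξl (v : V) : D ξ v = 0 := by
    refine ext_inner_right ℝ fun w ↦ ?_
    have h₁ := hcyc ξ v w
    rw [hskew' v ξ w, hξr, hξr, inner_zero_left, inner_zero_left] at h₁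
    rw [inner_zero_left]
    linarith
  -- The cyclic sum turns normality into a relation `a + b = c` whose rotation is `b + c = a`.
  have hrot (u v w : V) :
      inner ℝ (D (φ u) v) w + inner ℝ (D (φ v) w) u = inner ℝ (D (φ w) u) v := by
    have h₁ := hN u v w
    have h₂ := hcyc u v (φ w)
    have h₃ := hskew' (φ v) w u
    have h₄ := hskew' v u (φ w)
    linarith
  have hzero (u v w : V) : inner ℝ (D (φ u) v) w = 0 := by
    linarith [hrot w u v, hrot u v w]
  refine ⟨fun u v ↦ ext_inner_right ℝ fun w ↦ ?_, hh⟩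
  have h₁ := hzero (φ u) v w
  rw [hφ.φ_φ, map_add, map_neg, map_smul, LinearMap.add_apply, LinearMap.neg_apply,
    LinearMap.smul_apply, hξl, smul_zero, add_zero, inner_neg_left] at h₁
  rw [inner_zero_left]
  linarith

/-- The symmetries of `D = ∇φ` and `h = ∇ξ` on an `α`-cosymplectic structure determine both. -/
lemma eq_of_alphaCosymplectic (hφ : IsAlmostContact φ ξ η) {α : ℝ} {D : V →ₗ[ℝ] V →ₗ[ℝ] V}
    {h : V →ₗ[ℝ] V}
    (hskew : ∀ u v w, inner ℝ (D u v) w + inner ℝ v (D u w) = 0)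
    (hcyc : ∀ u v w, inner ℝ (D u v) w + inner ℝ (D v w) u + inner ℝ (D w u) v
      = 2 * α * (η u * inner ℝ (φ v) w + η v * inner ℝ (φ w) u + η w * inner ℝ (φ u) v))
    (hnormal : ∀ u v, D (φ u) v - D (φ v) u + φ (D v u) - φ (D u v) = 0)
    (hsq : ∀ u v, D u (φ v) + φ (D u v) = inner ℝ (h u) v • ξ + η v • h u)
    (hsymm : ∀ u v, inner ℝ (h u) v = inner ℝ (h v) u)
    (hη : ∀ u, η (h u) = 0) (hξ : ∀ u, D u ξ = -φ (h u)) :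
    (∀ u v, D u v = α • (inner ℝ (φ u) v • ξ - η v • φ u)) ∧ ∀ u, h u = α • (u - η u • ξ) := by
  have hsw (u v : V) : inner ℝ (φ v) u = -inner ℝ (φ u) v := by
    rw [real_inner_comm, hφ.inner_φ_right]
  -- The right-hand sides solve the same equations, so the differences solve those with `α = 0`.
  let D₀ : V →ₗ[ℝ] V →ₗ[ℝ] V := LinearMap.mk₂ ℝ (fun u v ↦ α • (inner ℝ (φ u) v • ξ - η v • φ u))
    (fun u₁ u₂ v ↦ by rw [map_add, inner_add_left]; module)
    (fun c u v ↦ by rw [map_smul, real_inner_smul_left]; module)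
    (fun u v₁ v₂ ↦ by rw [map_add, inner_add_right]; module)
    (fun c u v ↦ by rw [map_smul, real_inner_smul_right, smul_eq_mul]; module)
  have hD₀ (u v : V) : D₀ u v = α • (inner ℝ (φ u) v • ξ - η v • φ u) := rfl
  let h₀ : V →ₗ[ℝ] V := α • (LinearMap.id - (η : V →ₗ[ℝ] ℝ).smulRight ξ)
  have hh₀ (u : V) : h₀ u = α • (u - η u • ξ) := rfl
  have key := hφ.eq_zero_of_cosymplectic (D := D - D₀) (h := h - h₀) ?_ ?_ ?_ ?_ ?_ ?_ ?_
  · exact ⟨fun u v ↦ sub_eq_zero.mp (key.1 u v), fun u ↦ sub_eq_zero.mp (key.2 u)⟩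
  all_goals simp only [LinearMap.sub_apply, hD₀, hh₀]
  · intro u v w
    simp only [inner_sub_left, inner_sub_right, real_inner_smul_left, real_inner_smul_right,
      hφ.inner_ξ_left, hφ.inner_ξ, hφ.inner_φ_right]
    linear_combination hskew u v w - α * η w * hsw u v
  · intro u v w
    simp only [inner_sub_left, real_inner_smul_left, hφ.inner_ξ_left]
    linear_combination hcyc u v w + α * η w * hsw v u + α * η u * hsw v w + α * η v * hsw w u
  · intro u v
    simp only [map_sub, map_smul, hφ.φ_φ, hφ.φ_ξ, inner_add_left, inner_neg_left,
      real_inner_smul_left, hφ.inner_ξ_left]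
    rw [real_inner_comm v u]
    linear_combination (norm := module) hnormal u v
  · intro u v
    simp only [map_sub, map_smul, hφ.φ_φ, hφ.φ_ξ, hφ.η_φ, inner_sub_left, real_inner_smul_left,
      hφ.inner_φ_φ, hφ.inner_ξ_left]
    linear_combination (norm := module) hsq u v
  · intro u v
    simp only [inner_sub_left, real_inner_smul_left, hφ.inner_ξ_left]
    linear_combination hsymm u v + α * real_inner_comm u v
  · intro u
    simp only [map_sub, map_smul, hη, hφ.η_ξ, smul_eq_mul]
    ring
  · intro u
    simp only [map_sub, map_smul, hξ, hφ.inner_ξ, hφ.η_φ, hφ.η_ξ, hφ.φ_ξ]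
    module

end IsAlmostContact

end AlmostContactAlgebra

/-! ### Linear algebra of curvature tensors -/

section CurvatureAlgebra

variable {V : Type*} [NormedAddCommGroup V] [InnerProductSpace ℝ V]

/-- An operation `R(u, v)w` with the symmetries of the Riemann curvature tensor. Multilinearity is
not required: it follows from the pair symmetry. -/
structure IsCurvatureLike (R : V → V → V → V) : Prop where
  swap : ∀ u v w, R u v w = -R v u w
  skew : ∀ u v w z, inner ℝ (R u v w) z + inner ℝ w (R u v z) = 0
  bianchi : ∀ u v w, R u v w + R v w u + R w u v = 0

namespace IsCurvatureLike

variable {R : V → V → V → V}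

lemma inner_swap (hR : IsCurvatureLike R) (u v w z : V) :
    inner ℝ (R u v w) z = -inner ℝ (R v u w) z := by
  rw [hR.swap, inner_neg_left]

lemma inner_skew (hR : IsCurvatureLike R) (u v w z : V) :
    inner ℝ (R u v w) z = -inner ℝ (R u v z) w := by
  rw [real_inner_comm w]
  linarith [hR.skew u v w z]

lemma inner_bianchi (hR : IsCurvatureLike R) (u v w z : V) :
    inner ℝ (R u v w) z + inner ℝ (R v w u) z + inner ℝ (R w u v) z = 0 := by
  rw [← inner_add_left, ← inner_add_left, hR.bianchi, inner_zero_left]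

/-- The symmetry in pairs, a combination of four first Bianchi identities. -/
lemma pair_symm (hR : IsCurvatureLike R) (u v w z : V) :
    inner ℝ (R u v w) z = inner ℝ (R w z u) v := by
  linarith [hR.inner_bianchi u v w z, hR.inner_bianchi v w z u, hR.inner_bianchi w z u v,
    hR.inner_bianchi z u v w, hR.inner_skew u v w z, hR.inner_skew v w u z, hR.inner_skew w u v z,
    hR.inner_skew v w z u, hR.inner_skew w z v u, hR.inner_skew z v w u, hR.inner_skew w z u v,
    hR.inner_skew z u w v, hR.inner_skew u w z v, hR.inner_skew z u v w, hR.inner_skew u v z w,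
    hR.inner_skew v z u w, hR.inner_swap u v w z, hR.inner_swap v w u z, hR.inner_swap w u v z,
    hR.inner_swap u v z w, hR.inner_swap v w z u, hR.inner_swap w u z v, hR.inner_swap w z u v,
    hR.inner_swap w z v u, hR.inner_swap z u v w, hR.inner_swap z u w v, hR.inner_swap z v w u,
    hR.inner_swap z v u w]

lemma inner_isBilinearMap (hR : IsCurvatureLike R) (v z : V) :
    IsBilinearMap ℝ (fun u w ↦ inner ℝ (R u v w) z) where
  add_left u₁ u₂ w := by
    simp only [hR.pair_symm _ v w z, hR.inner_skew w z _ v, inner_add_right]; ring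
  smul_left c u w := by
    simp only [hR.pair_symm _ v w z, hR.inner_skew w z _ v, real_inner_smul_right, smul_eq_mul]
    ring
  add_right u w₁ w₂ := by simp only [hR.inner_skew u v _ z, inner_add_right]; ring
  smul_right c u w := by
    simp only [hR.inner_skew u v _ z, real_inner_smul_right, smul_eq_mul]; ring

end IsCurvatureLike

variable {ι : Type*} [Fintype ι] {φ : V →L[ℝ] V} {ξ : V} {η : V →L[ℝ] ℝ}

/-- In a contraction, a skew-symmetric endomorphism moves to the other argument with a sign. -/
lemma IsAlmostContact.sum_bilinear_φ_left (hφ : IsAlmostContact φ ξ η)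
    (e : OrthonormalBasis ι ℝ V) {B : V → V → ℝ} (hB : IsBilinearMap ℝ B) :
    ∑ i, B (φ (e i)) (e i) = -∑ i, B (e i) (φ (e i)) := by
  have hexp (i : ι) : φ (e i) = ∑ j, inner ℝ (e j) (φ (e i)) • e j := (e.sum_repr' _).symm
  have hL (u v : V) : B u v = hB.toLinearMap u v := rfl
  have h₁ (i : ι) : B (φ (e i)) (e i) = ∑ j, inner ℝ (e j) (φ (e i)) * B (e j) (e i) := by
    conv_lhs => rw [hexp i]
    simp only [hL, map_sum, map_smul, LinearMap.sum_apply, LinearMap.smul_apply, smul_eq_mul]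
  have h₂ (i : ι) : B (e i) (φ (e i)) = ∑ j, inner ℝ (e j) (φ (e i)) * B (e i) (e j) := by
    conv_lhs => rw [hexp i]
    simp only [hL, map_sum, map_smul, smul_eq_mul]
  simp only [h₁, h₂]
  rw [Finset.sum_comm, ← Finset.sum_neg_distrib]
  refine Finset.sum_congr rfl fun i _ ↦ ?_
  rw [← Finset.sum_neg_distrib]
  refine Finset.sum_congr rfl fun j _ ↦ ?_
  rw [hφ.inner_φ_right, real_inner_comm]
  ring

/-- The `∗`-Ricci tensor of the quarter-symmetric metric connection of an `α`-cosymplectic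
structure in terms of the Ricci tensor of the metric. The first Bianchi identity turns the
contraction of `φ ∘ R(v, φ w)` into one of `R(v, ·)φ ·`, and the commutator of `φ` with the
curvature reduces that to the Ricci tensor. -/
lemma IsCurvatureLike.starRicci_eq {R R' : V → V → V → V} (hR : IsCurvatureLike R)
    (hφ : IsAlmostContact φ ξ η) {α : ℝ}
    (hRξ : ∀ u v, R u v ξ = α ^ 2 • (η u • v - η v • u))
    (hRφ : ∀ u v w, R u v (φ w) = φ (R u v w) + α ^ 2 • (inner ℝ (φ v) w • u
      - inner ℝ (φ u) w • v + inner ℝ v w • φ u - inner ℝ u w • φ v))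
    (hR' : ∀ u v w, R' u v w = R u v w + α • (η u • (inner ℝ (φ v) w • ξ - η w • φ v)
      - η v • (inner ℝ (φ u) w • ξ - η w • φ u)))
    (e : OrthonormalBasis ι ℝ V) (v w : V) :
    (1 / 2) * ∑ i, inner ℝ (φ (R' v (φ w) (e i))) (e i)
      = ∑ i, inner ℝ (R (e i) v w) (e i)
        + α ^ 2 * (((Fintype.card ι : ℝ) - 2) * inner ℝ v w + η v * η w) := by
  have hη (u : V) : ∑ i, η (e i) * inner ℝ (e i) u = η u := by
    simp only [← hφ.inner_ξ_left]
    exact e.sum_inner_mul_inner ξ u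
  -- The difference `R' - R` contributes a multiple of `η (φ³ w) = 0`.
  have h₁ : ∑ i, inner ℝ (φ (R' v (φ w) (e i))) (e i)
      = -∑ i, inner ℝ (R v (φ w) (e i)) (φ (e i)) := by
    have (i : ι) : inner ℝ (φ (R' v (φ w) (e i))) (e i)
        = -inner ℝ (R v (φ w) (e i)) (φ (e i))
          - α * η v * (η (e i) * inner ℝ (e i) (φ (φ (φ w)))) := by
      rw [hR', hφ.η_φ, hφ.inner_φ_right, real_inner_comm (φ (φ (φ w))) (e i)]
      simp only [map_add, map_sub, map_smul, hφ.φ_ξ, inner_add_left, inner_sub_left,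
        real_inner_smul_left, inner_zero_left, zero_smul, map_zero]
      ring
    simp only [this, Finset.sum_sub_distrib, Finset.sum_neg_distrib, ← Finset.mul_sum, hη, hφ.η_φ]
    ring
  -- The two terms of the first Bianchi identity agree after moving `φ` across the contraction.
  have h₂ : ∑ i, inner ℝ (R v (φ w) (e i)) (φ (e i))
      = -(2 * ∑ i, inner ℝ (R v (e i) (φ (e i))) (φ w)) := by
    have (i : ι) : inner ℝ (R v (φ w) (e i)) (φ (e i))
        = -inner ℝ (R (φ (e i)) v (e i)) (φ w) - inner ℝ (R v (e i) (φ (e i))) (φ w) := by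
      rw [hR.pair_symm]
      linarith [hR.inner_bianchi (e i) (φ (e i)) v (φ w)]
    have hsum := hφ.sum_bilinear_φ_left e (hR.inner_isBilinearMap v (φ w))
    simp only [hR.inner_swap (e _) v (φ _) (φ w), Finset.sum_neg_distrib, neg_neg] at hsum
    simp only [this, Finset.sum_sub_distrib, Finset.sum_neg_distrib, hsum]
    ring
  have h₃ (i : ι) : inner ℝ (R v (e i) (φ (e i))) (φ w)
      = inner ℝ (R (e i) v w) (e i) + α ^ 2 * (inner ℝ (φ v) (φ w) + η v * η w
        - inner ℝ (φ v) (e i) * inner ℝ (e i) (φ w) - inner ℝ v (e i) * inner ℝ (e i) w) := by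
    have hη' : η (R v (e i) (e i)) = -(α ^ 2 * (η v - η (e i) * inner ℝ (e i) v)) := by
      rw [← hφ.inner_ξ, hR.inner_skew, hRξ, real_inner_smul_left, inner_sub_left,
        real_inner_smul_left, real_inner_smul_left, real_inner_self_eq_norm_sq, e.norm_eq_one,
        real_inner_comm v]
      ring
    rw [hRφ, inner_add_left, hφ.inner_φ_φ, hη', hR.inner_skew (e i) v, hR.inner_swap v (e i),
      real_inner_smul_left]
    simp only [inner_sub_left, inner_add_left, real_inner_smul_left, hφ.inner_φ_self,
      real_inner_self_eq_norm_sq, e.norm_eq_one, hφ.inner_φ_φ (e i) w]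
    rw [real_inner_comm (e i) v]
    ring
  rw [h₁, h₂]
  simp only [h₃, Finset.sum_add_distrib, Finset.sum_sub_distrib, ← Finset.mul_sum,
    e.sum_inner_mul_inner, Finset.sum_const, Finset.card_univ, nsmul_eq_mul,
    hφ.inner_φ_φ]
  ring

end CurvatureAlgebra

/-! ### Covariant derivatives on an `α`-cosymplectic manifold -/

section AlphaCosymplectic

variable {E : Type*} [NormedAddCommGroup E] [NormedSpace ℝ E] [FiniteDimensional ℝ E]
  {H : Type*} [TopologicalSpace H] {I : ModelWithCorners ℝ E H}
  {M : Type*} [TopologicalSpace M] [ChartedSpace H M] [IsManifold I ∞ M]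
  [RiemannianBundle (fun x : M ↦ TangentSpace I x)]
  {cov : LinearConnection I M} {X Y Z : Π x : M, TangentSpace I x}

namespace AlmostContactMetricStructure

variable (S : AlmostContactMetricStructure I M)

lemma isAlmostContact (x : M) : IsAlmostContact (S.φ x) (S.ξ x) (S.η x) where
  φ_φ := S.φ_φ x
  η_ξ := S.η_ξ x
  η_φ := S.η_φ x
  φ_ξ := S.φ_ξ x
  inner_φ_right := S.inner_φ_right x
  inner_ξ := S.inner_ξ x

lemma isSmoothField_ξ : IsSmoothField S.ξ := S.smooth_ξ

lemma isSmoothField_φ (hX : IsSmoothField X) : IsSmoothField (fun y ↦ S.φ y (X y)) :=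
  ContMDiff.clm_bundle_apply S.smooth_φ hX

/-- The covariant derivative of `φ`, `(Y, X) ↦ ∇_X (φ Y) - φ (∇_X Y)`, is tensorial in `Y`. -/
lemma tensorialAt_cov_φ (cov : LinearConnection I M) (x : M) :
    TensorialAt I E (fun Y : Π x : M, TangentSpace I x ↦
      cov (fun y ↦ S.φ y (Y y)) x - (S.φ x).comp (cov Y x)) x where
  smul {f Y} hf hY := by
    have hφY := MDifferentiableAt.clm_bundle_apply ((S.smooth_φ x).mdifferentiableAt (by simp)) hY
    have h₁ : (fun y ↦ S.φ y ((f • Y) y)) = f • fun y ↦ S.φ y (Y y) := by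
      ext1 y; simp
    rw [h₁, cov.isCovariantDerivativeOnUniv.leibniz hφY hf,
      cov.isCovariantDerivativeOnUniv.leibniz hY hf]
    ext u
    simp
    module
  add {Y Y'} hY hY' := by
    have hφ {U : Π x : M, TangentSpace I x} (hU) := MDifferentiableAt.clm_bundle_apply (v := U)
      ((S.smooth_φ x).mdifferentiableAt (by simp)) hU
    have h₁ : (fun y ↦ S.φ y ((Y + Y') y)) = (fun y ↦ S.φ y (Y y)) + fun y ↦ S.φ y (Y' y) := by
      ext1 y; simp
    rw [h₁, cov.isCovariantDerivativeOnUniv.add (hφ hY) (hφ hY'),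
      cov.isCovariantDerivativeOnUniv.add hY hY']
    ext u
    simp
    module

/-- The covariant derivative `(u, v) ↦ (∇_u φ)v` of the endomorphism field `φ`, as a bilinear map
on the tangent space. -/
def covφ (cov : LinearConnection I M) (x : M) :
    TangentSpace I x →ₗ[ℝ] TangentSpace I x →ₗ[ℝ] TangentSpace I x :=
  LinearMap.flip <| LinearMap.mk₂ ℝ
    (fun v u ↦ TensorialAt.mkHom _ x (S.tensorialAt_cov_φ cov x) v u)
    (fun _ _ _ ↦ by rw [map_add]; rfl) (fun _ _ _ ↦ by rw [map_smul]; rfl)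
    (fun _ _ _ ↦ map_add _ _ _) (fun _ _ _ ↦ map_smul _ _ _)

lemma covφ_apply (hY : IsSmoothField Y) (x : M) (u : TangentSpace I x) :
    S.covφ cov x u (Y x) = cov (fun y ↦ S.φ y (Y y)) x u - S.φ x (cov Y x u) := by
  have h := TensorialAt.mkHom_apply (S.tensorialAt_cov_φ cov x) (hY.mdifferentiableAt x)
  exact congrArg (fun A : TangentSpace I x →L[ℝ] TangentSpace I x ↦ A u) h

variable [IsContMDiffRiemannianBundle I ∞ E (fun x : M ↦ TangentSpace I x)] {S}

lemma contMDiff_η (hX : IsSmoothField X) : ContMDiff I 𝓘(ℝ, ℝ) ∞ (fun y ↦ S.η y (X y)) := by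
  simp only [← S.inner_ξ]
  exact hX.inner S.isSmoothField_ξ

lemma mvfderiv_η
    (hmet : CovariantDerivative.IsMetricCompatible (V := fun x : M ↦ TangentSpace I x) cov)
    (hX : IsSmoothField X) (x : M) (u : TangentSpace I x) :
    mvfderiv I (fun y ↦ S.η y (X y)) x u
      = S.η x (cov X x u) + inner ℝ (cov S.ξ x u) (X x) := by
  have h : (fun y ↦ S.η y (X y)) = fun y ↦ inner ℝ (X y) (S.ξ y) := by
    ext y; rw [S.inner_ξ]
  rw [h, mvfderiv_inner hmet hX S.isSmoothField_ξ, S.inner_ξ, real_inner_comm (X x)]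

variable [T2Space M]

/-- The covariant derivatives of `φ` and `ξ` on an `α`-cosymplectic manifold. -/
lemma IsAlphaCosymplectic.covφ_and_cov_ξ {α : ℝ} (hS : S.IsAlphaCosymplectic α)
    (hLC : IsLeviCivita cov) (x : M) :
    (∀ u v, S.covφ cov x u v = α • (inner ℝ (S.φ x u) v • S.ξ x - S.η x v • S.φ x u)) ∧
      ∀ u, cov S.ξ x u = α • (u - S.η x u • S.ξ x) := by
  have hξ := S.isSmoothField_ξ
  refine (S.isAlmostContact x).eq_of_alphaCosymplectic (h := (cov S.ξ x : _ →ₗ[ℝ] _))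
    ?_ ?_ ?_ ?_ ?_ ?_ ?_
  · intro u v w
    obtain ⟨V, hV, rfl⟩ := exists_isSmoothField_apply_eq x v
    obtain ⟨W, hW, rfl⟩ := exists_isSmoothField_apply_eq x w
    have h₁ : (fun y ↦ inner ℝ (S.φ y (V y)) (W y))
        = fun y ↦ -inner ℝ (V y) (S.φ y (W y)) := by
      ext y; rw [S.inner_φ_right, neg_neg]
    have h₂ := congrArg (fun f ↦ mvfderiv I f x u) h₁
    simp only [mvfderiv_fun_neg, neg_apply, mvfderiv_inner hLC.metric (S.isSmoothField_φ hV) hW,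
      mvfderiv_inner hLC.metric hV (S.isSmoothField_φ hW)] at h₂
    rw [S.covφ_apply hV, S.covφ_apply hW, inner_sub_left, inner_sub_right]
    have h₃ := S.inner_φ_right x (cov V x u) (W x)
    have h₄ := S.inner_φ_right x (V x) (cov W x u)
    linarith
  · intro u v w
    obtain ⟨U, hU, rfl⟩ := exists_isSmoothField_apply_eq x u
    obtain ⟨V, hV, rfl⟩ := exists_isSmoothField_apply_eq x v
    obtain ⟨W, hW, rfl⟩ := exists_isSmoothField_apply_eq x w
    have h := hS.dΦ_eq x U V W (hU x) (hV x) (hW x)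
    simp only [dΦ, Φ, ηwedgeΦ] at h
    rw [mvfderiv_inner hLC.metric (S.isSmoothField_φ hV) hW,
      mvfderiv_inner hLC.metric (S.isSmoothField_φ hW) hU,
      mvfderiv_inner hLC.metric (S.isSmoothField_φ hU) hV,
      ← cov_sub_cov_of_torsion_eq_zero hLC.torsion_eq_zero hU hV,
      ← cov_sub_cov_of_torsion_eq_zero hLC.torsion_eq_zero hV hW,
      ← cov_sub_cov_of_torsion_eq_zero hLC.torsion_eq_zero hW hU] at h
    have hsw (a b : TangentSpace I x) : inner ℝ (S.φ x a) b = -inner ℝ (S.φ x b) a := by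
      rw [real_inner_comm, S.inner_φ_right]
    simp only [map_sub, inner_sub_left] at h
    rw [S.covφ_apply hU, S.covφ_apply hV, S.covφ_apply hW, inner_sub_left, inner_sub_left,
      inner_sub_left]
    linarith [hsw (V x) (cov W x (U x)), hsw (W x) (cov U x (V x)), hsw (U x) (cov V x (W x))]
  · intro u v
    obtain ⟨U, hU, rfl⟩ := exists_isSmoothField_apply_eq x u
    obtain ⟨V, hV, rfl⟩ := exists_isSmoothField_apply_eq x v
    have h := hS.normal x U V (hU x) (hV x)
    have hφU := S.isSmoothField_φ hU
    have hφV := S.isSmoothField_φ hV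
    simp only [normalityTensor, hS.dη_eq_zero x U V (hU x) (hV x),
      ← cov_sub_cov_of_torsion_eq_zero hLC.torsion_eq_zero hφU hφV,
      ← cov_sub_cov_of_torsion_eq_zero hLC.torsion_eq_zero hφU hV,
      ← cov_sub_cov_of_torsion_eq_zero hLC.torsion_eq_zero hU hφV,
      ← cov_sub_cov_of_torsion_eq_zero hLC.torsion_eq_zero hU hV, map_sub] at h
    simp only [S.covφ_apply hU, S.covφ_apply hV, map_sub]
    linear_combination (norm := module) h
  · intro u v
    obtain ⟨V, hV, rfl⟩ := exists_isSmoothField_apply_eq x v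
    have h₁ : (fun y ↦ S.φ y (S.φ y (V y)))
        = (fun y ↦ S.η y (V y)) • S.ξ - V := by
      ext1 y
      rw [S.φ_φ]
      simp only [Pi.sub_apply, Pi.smul_apply']
      abel
    have h₂ := S.covφ_apply (cov := cov) (S.isSmoothField_φ hV) x u
    rw [h₁, cov_sub_apply (hξ.smul (contMDiff_η hV)) hV, cov_smul_apply (contMDiff_η hV) hξ,
      mvfderiv_η hLC.metric hV] at h₂
    rw [h₂, S.covφ_apply hV, map_sub, S.φ_φ]
    simp only [ContinuousLinearMap.coe_coe]
    module
  · intro u v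
    obtain ⟨U, hU, rfl⟩ := exists_isSmoothField_apply_eq x u
    obtain ⟨V, hV, rfl⟩ := exists_isSmoothField_apply_eq x v
    have h := hS.dη_eq_zero x U V (hU x) (hV x)
    rw [dη, mvfderiv_η hLC.metric hU, mvfderiv_η hLC.metric hV,
      ← cov_sub_cov_of_torsion_eq_zero hLC.torsion_eq_zero hU hV, map_sub] at h
    simp only [ContinuousLinearMap.coe_coe]
    linarith
  · intro u
    have h₁ : (fun y ↦ S.η y (S.ξ y)) = fun _ ↦ (1 : ℝ) := by
      ext y; rw [S.η_ξ]
    have h₂ := mvfderiv_η (S := S) hLC.metric hξ x u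
    rw [h₁, mvfderiv_const, S.inner_ξ] at h₂
    simp only [zero_apply] at h₂
    simp only [ContinuousLinearMap.coe_coe]
    linarith
  · intro u
    have h₁ : (fun y ↦ S.φ y (S.ξ y)) = 0 := by
      ext1 y; rw [S.φ_ξ]; rfl
    rw [S.covφ_apply hξ, h₁, cov.zero]
    simp

end AlmostContactMetricStructure

end AlphaCosymplectic

/-! ### Curvature of an `α`-cosymplectic manifold -/

section CurvatureAlphaCosymplectic

variable {E : Type*} [NormedAddCommGroup E] [NormedSpace ℝ E] [FiniteDimensional ℝ E]
  {H : Type*} [TopologicalSpace H] {I : ModelWithCorners ℝ E H}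
  {M : Type*} [TopologicalSpace M] [ChartedSpace H M] [IsManifold I ∞ M]
  [RiemannianBundle (fun x : M ↦ TangentSpace I x)]
  [IsContMDiffRiemannianBundle I ∞ E (fun x : M ↦ TangentSpace I x)] [T2Space M]
  {cov cov' : LinearConnection I M} {X Y Z : Π x : M, TangentSpace I x}

lemma IsLeviCivita.isCurvatureLike (hLC : IsLeviCivita cov) (x : M) :
    IsCurvatureLike (curvatureAt cov x) where
  swap u v w := by
    obtain ⟨U, hU, rfl⟩ := exists_isSmoothField_apply_eq x u
    obtain ⟨V, hV, rfl⟩ := exists_isSmoothField_apply_eq x v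
    obtain ⟨W, hW, rfl⟩ := exists_isSmoothField_apply_eq x w
    rw [curvatureAt_apply hLC.smooth hLC.metric hU hV hW,
      curvatureAt_apply hLC.smooth hLC.metric hV hU hW, curvature_swap]
  skew u v w z := by
    obtain ⟨U, hU, rfl⟩ := exists_isSmoothField_apply_eq x u
    obtain ⟨V, hV, rfl⟩ := exists_isSmoothField_apply_eq x v
    obtain ⟨W, hW, rfl⟩ := exists_isSmoothField_apply_eq x w
    obtain ⟨Z, hZ, rfl⟩ := exists_isSmoothField_apply_eq x z
    rw [curvatureAt_apply hLC.smooth hLC.metric hU hV hW,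
      curvatureAt_apply hLC.smooth hLC.metric hU hV hZ]
    exact inner_curvature_add hLC.smooth hLC.metric hU hV hW hZ x
  bianchi u v w := by
    obtain ⟨U, hU, rfl⟩ := exists_isSmoothField_apply_eq x u
    obtain ⟨V, hV, rfl⟩ := exists_isSmoothField_apply_eq x v
    obtain ⟨W, hW, rfl⟩ := exists_isSmoothField_apply_eq x w
    rw [curvatureAt_apply hLC.smooth hLC.metric hU hV hW,
      curvatureAt_apply hLC.smooth hLC.metric hV hW hU,
      curvatureAt_apply hLC.smooth hLC.metric hW hU hV]
    exact curvature_bianchi hLC.smooth hLC.torsion_eq_zero hU hV hW x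

namespace AlmostContactMetricStructure

variable {S : AlmostContactMetricStructure I M} {α : ℝ}

lemma IsAlphaCosymplectic.cov_ξ (hS : S.IsAlphaCosymplectic α) (hLC : IsLeviCivita cov) (x : M)
    (u : TangentSpace I x) : cov S.ξ x u = α • (u - S.η x u • S.ξ x) :=
  (hS.covφ_and_cov_ξ hLC x).2 u

lemma IsAlphaCosymplectic.cov_φ (hS : S.IsAlphaCosymplectic α) (hLC : IsLeviCivita cov)
    (hY : IsSmoothField Y) (x : M) (u : TangentSpace I x) :
    cov (fun y ↦ S.φ y (Y y)) x u = S.φ x (cov Y x u)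
      + α • (inner ℝ (S.φ x u) (Y x) • S.ξ x - S.η x (Y x) • S.φ x u) := by
  rw [← (hS.covφ_and_cov_ξ hLC x).1, S.covφ_apply hY]
  abel

lemma IsAlphaCosymplectic.mvfderiv_η (hS : S.IsAlphaCosymplectic α) (hLC : IsLeviCivita cov)
    (hY : IsSmoothField Y) (x : M) (u : TangentSpace I x) :
    mvfderiv I (fun y ↦ S.η y (Y y)) x u
      = S.η x (cov Y x u) + α * (inner ℝ u (Y x) - S.η x u * S.η x (Y x)) := by
  rw [AlmostContactMetricStructure.mvfderiv_η hLC.metric hY, hS.cov_ξ hLC, real_inner_smul_left,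
    inner_sub_left, real_inner_smul_left, (S.isAlmostContact x).inner_ξ_left]

lemma IsAlphaCosymplectic.curvatureAt_ξ (hS : S.IsAlphaCosymplectic α) (hLC : IsLeviCivita cov)
    (x : M) (u v : TangentSpace I x) :
    curvatureAt cov x u v (S.ξ x) = α ^ 2 • (S.η x u • v - S.η x v • u) := by
  have hξ := S.isSmoothField_ξ
  obtain ⟨U, hU, rfl⟩ := exists_isSmoothField_apply_eq x u
  obtain ⟨V, hV, rfl⟩ := exists_isSmoothField_apply_eq x v
  have hfield (W : Π x : M, TangentSpace I x) :
      (fun y ↦ cov S.ξ y (W y)) = α • (W - (fun y ↦ S.η y (W y)) • S.ξ) := by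
    ext1 y
    exact hS.cov_ξ hLC y (W y)
  have hcov {W : Π x : M, TangentSpace I x} (hW : IsSmoothField W) (w : TangentSpace I x) :
      cov (fun y ↦ cov S.ξ y (W y)) x w = α • (cov W x w - (S.η x (W x) •
        (α • (w - S.η x w • S.ξ x))
        + (S.η x (cov W x w) + α * (inner ℝ w (W x) - S.η x w * S.η x (W x))) • S.ξ x)) := by
    have hηW := contMDiff_η (S := S) hW
    rw [hfield, cov_const_smul_apply _ (hW.sub (hξ.smul hηW)), cov_sub_apply hW (hξ.smul hηW),
      cov_smul_apply hηW hξ, hS.mvfderiv_η hLC hW, hS.cov_ξ hLC]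
  rw [curvatureAt_apply hLC.smooth hLC.metric hU hV hξ, curvature, hcov hU, hcov hV, hS.cov_ξ hLC,
    ← cov_sub_cov_of_torsion_eq_zero hLC.torsion_eq_zero hU hV, map_sub, real_inner_comm (U x)]
  module

lemma IsAlphaCosymplectic.curvatureAt_φ (hS : S.IsAlphaCosymplectic α) (hLC : IsLeviCivita cov)
    (x : M) (u v w : TangentSpace I x) :
    curvatureAt cov x u v (S.φ x w) = S.φ x (curvatureAt cov x u v w)
      + α ^ 2 • (inner ℝ (S.φ x v) w • u - inner ℝ (S.φ x u) w • v
        + inner ℝ v w • S.φ x u - inner ℝ u w • S.φ x v) := by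
  have hξ := S.isSmoothField_ξ
  obtain ⟨U, hU, rfl⟩ := exists_isSmoothField_apply_eq x u
  obtain ⟨V, hV, rfl⟩ := exists_isSmoothField_apply_eq x v
  obtain ⟨W, hW, rfl⟩ := exists_isSmoothField_apply_eq x w
  have hφW := S.isSmoothField_φ hW
  have hcov {Y : Π x : M, TangentSpace I x} (hY : IsSmoothField Y) (u : TangentSpace I x) :
      cov (fun y ↦ cov (fun y ↦ S.φ y (W y)) y (Y y)) x u
        = S.φ x (cov (fun y ↦ cov W y (Y y)) x u)
          + α • (inner ℝ (S.φ x u) (cov W x (Y x)) • S.ξ x - S.η x (cov W x (Y x)) • S.φ x u)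
          + α • ((inner ℝ (S.φ x (Y x)) (W x) • (α • (u - S.η x u • S.ξ x))
            + (inner ℝ (S.φ x (cov Y x u) + α • (inner ℝ (S.φ x u) (Y x) • S.ξ x
                - S.η x (Y x) • S.φ x u)) (W x)
              + inner ℝ (S.φ x (Y x)) (cov W x u)) • S.ξ x)
            - (S.η x (W x) • (S.φ x (cov Y x u) + α • (inner ℝ (S.φ x u) (Y x) • S.ξ x
                - S.η x (Y x) • S.φ x u))
            + (S.η x (cov W x u) + α * (inner ℝ u (W x) - S.η x u * S.η x (W x)))
              • S.φ x (Y x))) := by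
    have hcW := hW.covariantDerivative hLC.smooth hY
    have hφY := S.isSmoothField_φ hY
    have hηW := contMDiff_η (S := S) hW
    have hΦ := hφY.inner hW
    have hfield : (fun y ↦ cov (fun y ↦ S.φ y (W y)) y (Y y))
        = (fun y ↦ S.φ y (cov W y (Y y))) + α • ((fun y ↦ inner ℝ (S.φ y (Y y)) (W y)) • S.ξ
          - (fun y ↦ S.η y (W y)) • fun y ↦ S.φ y (Y y)) := by
      ext1 y
      exact hS.cov_φ hLC hW y (Y y)
    have h₁ := hξ.smul hΦ
    have h₂ := hφY.smul hηW
    rw [hfield, cov_add_apply (S.isSmoothField_φ hcW) ((h₁.sub h₂).const_smul α),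
      hS.cov_φ hLC hcW, cov_const_smul_apply α (h₁.sub h₂), cov_sub_apply h₁ h₂,
      cov_smul_apply hΦ hξ, cov_smul_apply hηW hφY, mvfderiv_inner hLC.metric hφY hW,
      hS.mvfderiv_η hLC hW, hS.cov_ξ hLC, hS.cov_φ hLC hY]
  rw [curvatureAt_apply hLC.smooth hLC.metric hU hV hW,
    curvatureAt_apply hLC.smooth hLC.metric hU hV hφW, curvature, curvature, hcov hU, hcov hV,
    hS.cov_φ hLC hW, ← cov_sub_cov_of_torsion_eq_zero hLC.torsion_eq_zero hU hV]
  have hsw : inner ℝ (S.φ x (V x)) (U x) = -inner ℝ (S.φ x (U x)) (V x) := by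
    rw [real_inner_comm, S.inner_φ_right]
  simp only [map_sub, inner_sub_left, inner_add_left, real_inner_smul_left,
    (S.isAlmostContact x).inner_ξ_left, hsw]
  module

end AlmostContactMetricStructure

/-! ### The quarter-symmetric metric connection and the soliton equation -/

section QuarterSymmetric

open AlmostContactMetricStructure

variable {S : AlmostContactMetricStructure I M} {α : ℝ}

/-- The quarter-symmetric metric connection is `∇ - η ⊗ φ`: a tensor `a(u, v, w)` that is symmetric
in `u, v` and skew in `v, w` vanishes. -/
lemma IsQuarterSymmetricMetric.cov_apply (hQS : IsQuarterSymmetricMetric S cov')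
    (hLC : IsLeviCivita cov) (hY : IsSmoothField Y) (x : M) (u : TangentSpace I x) :
    cov' Y x u = cov Y x u - S.η x u • S.φ x (Y x) := by
  obtain ⟨U, hU, rfl⟩ := exists_isSmoothField_apply_eq x u
  let a (X Y Z : Π x : M, TangentSpace I x) : ℝ :=
    inner ℝ (cov' Y x (X x) - cov Y x (X x) + S.η x (X x) • S.φ x (Y x)) (Z x)
  have hskew {X Y Z : Π x : M, TangentSpace I x} (hY : IsSmoothField Y) (hZ : IsSmoothField Z) :
      a X Y Z = -a X Z Y := by
    have h₁ := mvfderiv_inner hLC.metric hY hZ x (X x)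
    have h₂ := mvfderiv_inner hQS.metric hY hZ x (X x)
    have h₃ := S.inner_φ_right x (Y x) (Z x)
    simp only [a, inner_add_left, inner_sub_left, real_inner_smul_left]
    rw [real_inner_comm (Y x) (cov' Z x (X x)), real_inner_comm (Y x) (cov Z x (X x)),
      real_inner_comm (Y x) (S.φ x (Z x))]
    linear_combination h₁ - h₂ + S.η x (X x) * h₃
  have hsymm {X Y Z : Π x : M, TangentSpace I x} (hX : IsSmoothField X) (hY : IsSmoothField Y) :
      a X Y Z = a Y X Z := by
    have h₁ := cov_sub_cov_of_torsion_eq_zero hLC.torsion_eq_zero hX hY x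
    have h₂ := hQS.torsion_eq x (X x) (Y x)
    rw [cov'.torsion_apply (hX.mdifferentiableAt x) (hY.mdifferentiableAt x), ← h₁] at h₂
    refine congrArg (inner ℝ · (Z x)) ?_
    linear_combination (norm := module) h₂
  have hzero : cov' Y x (U x) - cov Y x (U x) + S.η x (U x) • S.φ x (Y x) = 0 := by
    refine ext_inner_right ℝ fun w ↦ ?_
    obtain ⟨W, hW, rfl⟩ := exists_isSmoothField_apply_eq x w
    rw [inner_zero_left]
    change a U Y W = 0
    linarith [hskew (X := U) hY hW, hsymm (Z := Y) hU hW, hskew (X := W) hU hY,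
      hsymm (Z := U) hW hY, hskew (X := Y) hW hU, hsymm (Z := W) hY hU]
  linear_combination (norm := module) hzero

/-- The curvature of the quarter-symmetric metric connection of an `α`-cosymplectic structure. -/
lemma IsQuarterSymmetricMetric.curvatureAt_eq (hQS : IsQuarterSymmetricMetric S cov')
    (hLC : IsLeviCivita cov) (hS : S.IsAlphaCosymplectic α) (x : M) (u v w : TangentSpace I x) :
    curvatureAt cov' x u v w = curvatureAt cov x u v w
      + α • (S.η x u • (inner ℝ (S.φ x v) w • S.ξ x - S.η x w • S.φ x v)
        - S.η x v • (inner ℝ (S.φ x u) w • S.ξ x - S.η x w • S.φ x u)) := by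
  obtain ⟨U, hU, rfl⟩ := exists_isSmoothField_apply_eq x u
  obtain ⟨V, hV, rfl⟩ := exists_isSmoothField_apply_eq x v
  obtain ⟨W, hW, rfl⟩ := exists_isSmoothField_apply_eq x w
  have hφW := S.isSmoothField_φ hW
  have hcov {Y : Π x : M, TangentSpace I x} (hY : IsSmoothField Y) (u : TangentSpace I x) :
      cov' (fun y ↦ cov' W y (Y y)) x u = cov (fun y ↦ cov W y (Y y)) x u
        - (S.η x (Y x) • (S.φ x (cov W x u)
            + α • (inner ℝ (S.φ x u) (W x) • S.ξ x - S.η x (W x) • S.φ x u))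
          + (S.η x (cov Y x u) + α * (inner ℝ u (Y x) - S.η x u * S.η x (Y x))) • S.φ x (W x))
        - S.η x u • S.φ x (cov W x (Y x) - S.η x (Y x) • S.φ x (W x)) := by
    have hcW := hW.covariantDerivative hLC.smooth hY
    have hηY := contMDiff_η (S := S) hY
    have hfield : (fun y ↦ cov' W y (Y y))
        = (fun y ↦ cov W y (Y y)) - (fun y ↦ S.η y (Y y)) • fun y ↦ S.φ y (W y) := by
      ext1 y
      exact hQS.cov_apply hLC hW y (Y y)
    rw [hfield, hQS.cov_apply hLC (hcW.sub (hφW.smul hηY)), cov_sub_apply hcW (hφW.smul hηY),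
      cov_smul_apply hηY hφW, hS.cov_φ hLC hW, hS.mvfderiv_η hLC hY]
    rfl
  rw [curvatureAt_apply hQS.smooth hQS.metric hU hV hW,
    curvatureAt_apply hLC.smooth hLC.metric hU hV hW, curvature, curvature, hcov hU, hcov hV,
    hQS.cov_apply hLC hW, ← cov_sub_cov_of_torsion_eq_zero hLC.torsion_eq_zero hU hV,
    real_inner_comm (U x) (V x)]
  simp only [map_sub, map_smul]
  module

lemma IsQuarterSymmetricMetric.starRicci_eq (hQS : IsQuarterSymmetricMetric S cov')
    (hLC : IsLeviCivita cov) (hS : S.IsAlphaCosymplectic α) (x : M) (v w : TangentSpace I x) :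
    starRicci cov' S.φ x v w = ricci cov x v w
      + α ^ 2 * (((Module.finrank ℝ E : ℝ) - 2) * inner ℝ v w + S.η x v * S.η x w) := by
  have h := (hLC.isCurvatureLike x).starRicci_eq (S.isAlmostContact x) (hS.curvatureAt_ξ hLC x)
    (hS.curvatureAt_φ hLC x) (hQS.curvatureAt_eq hLC hS x) (frame I x) v w
  rw [Fintype.card_fin] at h
  exact h

/-- The trace of the soliton equation, where the trace of `£̃_ξ g` is `2 div ξ`. -/
lemma IsQuarterSymmetricMetric.divergence_ξ (hQS : IsQuarterSymmetricMetric S cov')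
    (hLC : IsLeviCivita cov) (hS : S.IsAlphaCosymplectic α) {Λ μ : ℝ}
    (hsol : S.IsStarEtaRicciSoliton cov' Λ μ) (x : M) :
    divergence cov S.ξ x
      = -(Module.finrank ℝ E : ℝ) * (Λ + α ^ 2 * ((Module.finrank ℝ E : ℝ) - 2)) - μ
        - (α ^ 2 + scalarCurvature cov x) := by
  have hdiv : divergence cov S.ξ x = ∑ i, inner ℝ (frame I x i) (cov S.ξ x (frame I x i)) :=
    LinearMap.trace_eq_sum_inner _ (frame I x)
  have hη : ∑ i, S.η x (frame I x i) * S.η x (frame I x i) = 1 := by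
    have h := (frame I x).sum_inner_mul_inner (S.ξ x) (S.ξ x)
    simp only [(S.isAlmostContact x).inner_ξ_left, S.inner_ξ, S.η_ξ] at h
    exact h
  have hi (i) : 2 * inner ℝ (frame I x i) (cov S.ξ x (frame I x i))
      + 2 * ricci cov x (frame I x i) (frame I x i)
      + 2 * (α ^ 2 * ((Module.finrank ℝ E : ℝ) - 2)) + 2 * Λ
      + (2 * α ^ 2 + 2 * μ) * (S.η x (frame I x i) * S.η x (frame I x i)) = 0 := by
    have h := hsol x (frame I x i) (frame I x i)
    rw [lieDerivMetric, hQS.starRicci_eq hLC hS, hQS.cov_apply hLC S.isSmoothField_ξ, S.φ_ξ,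
      smul_zero, sub_zero, real_inner_self_eq_norm_sq, (frame I x).norm_eq_one,
      real_inner_comm (frame I x i)] at h
    linarith
  have hsum := Finset.sum_eq_zero (s := Finset.univ) fun i _ ↦ hi i
  simp only [Finset.sum_add_distrib, ← Finset.mul_sum, hη, ← hdiv, Finset.sum_const,
    Finset.card_univ, Fintype.card_fin, nsmul_eq_mul] at hsum
  have hdim : (Module.finrank ℝ (TangentSpace I x) : ℝ) = Module.finrank ℝ E := rfl
  rw [hdim] at hsum
  rw [scalarCurvature]
  linarith

end QuarterSymmetric

end CurvatureAlphaCosymplectic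

end StarEtaSoliton

end

theorem theorem5p1 {n : ℕ} {M : Type*} [TopologicalSpace M] [T2Space M]
    [ChartedSpace (EuclideanSpace ℝ (Fin n)) M] [IsManifold (𝓡 n) ∞ M]
    [RiemannianBundle (fun x : M ↦ TangentSpace (𝓡 n) x)]
    [IsContMDiffRiemannianBundle (𝓡 n) ∞ (EuclideanSpace ℝ (Fin n))
      (fun x : M ↦ TangentSpace (𝓡 n) x)]
    (S : StarEtaSoliton.AlmostContactMetricStructure (𝓡 n) M) (α : ℝ)
    (hS : S.IsAlphaCosymplectic α)
    (nabla : StarEtaSoliton.LinearConnection (𝓡 n) M)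
    (hnabla : StarEtaSoliton.IsLeviCivita nabla)
    (nablaTilde : StarEtaSoliton.LinearConnection (𝓡 n) M)
    (hnablaTilde : StarEtaSoliton.IsQuarterSymmetricMetric S nablaTilde)
    (Λ μ : ℝ) (hsol : S.IsStarEtaRicciSoliton nablaTilde Λ μ)
    (f : M → ℝ) (hf : ContMDiff (𝓡 n) 𝓘(ℝ, ℝ) ∞ f)
    (hξ : S.ξ = StarEtaSoliton.grad (𝓡 n) f) :
    ∀ x : M, StarEtaSoliton.laplacian nabla f x
      = -(n : ℝ) * (Λ + α ^ 2 * ((n : ℝ) - 2)) - μ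
        - (α ^ 2 + StarEtaSoliton.scalarCurvature nabla x) := by
  intro x
  have h := hnablaTilde.divergence_ξ hnabla hS hsol x
  rw [finrank_euclideanSpace_fin, hξ] at h
  exact h
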